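/- Consider a discrete memoryless broadcast interference channel with finite input alphabets $\mathcal X_1,\mathcal X_2$, finite output alphabets $\mathcal Y_1,\mathcal Y_2,\mathcal Y_3$ and transition probability $$p(y_1,y_2,y_3\mid x_1,x_2)=p(y_1\mid x_1)\,p(y_2\mid x_1,x_2)\,p(y_3\mid x_2).$$ Write $Y_1\prec_o Y_2$ (receiver 2 is interference-oblivious less noisy than receiver 1) if $I(U_1;Y_1)\le I(U_1;Y_2)$, and $Y_1\succ_c Y_2$ (receiver 1 is interference-cognizant less noisy than receiver 2) if $I(U_1;Y_1)\ge I(U_1;Y_2\mid X_2)$, in each case for every finite alphabet of $U_1$ and every input distribution $p(u_1,x_1)p(x_2)$ such that $U_1\to(X_1,X_2)\to(Y_1,Y_2)$ is a Markov chain. Let $\mathcal P'$ be the set of all distributions $P=P_{U_1}(u_1)P_{X_1|U_1}(x_1|u_1)P_{U_2}(u_2)P_{X_2|U_2}(x_2|u_2)$, where $U_1,U_2$ range over arbitrary finite alphabets and $(U_1,U_2)\to(X_1,X_2)\to(Y_1,Y_2,Y_3)$ is a Markov chain. For $P\in\mathcal P'$ define the following sets of triples $(R_1,R_2,R_3)$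 of non-negative reals. * $\mathcal R_{1,P}$: $R_1\le I(U_1;Y_1)$, $R_3\le I(X_2;Y_3)$, $R_1+R_2\le I(U_1;Y_1)+I(X_1;Y_2|U_1,U_2)$, $R_1+R_2+R_3\le I(U_1;Y_1)+I(X_1,U_2;Y_2|U_1)+I(X_2;Y_3|U_2)$. * $\mathcal R_{(1),P}$: $R_1\le I(U_1;Y_1)$, $R_2\le I(X_1;Y_2|U_1,U_2)$, $R_3\le I(X_2;Y_3)$, $R_2+R_3\le I(X_1,U_2;Y_2|U_1)+I(X_2;Y_3|U_2)$. * $\mathcal R_{2,P}$: $R_2\le I(U_1;Y_2|U_2)$, $R_3\le I(X_2;Y_3)$, $R_1+R_2\le I(X_1;Y_1|U_1)+I(U_1;Y_2|U_2)$, $R_2+R_3\le I(U_1,U_2;Y_2)+I(X_2;Y_3|U_2)$, $R_1+R_2+R_3\le I(X_1;Y_1|U_1)+I(U_1,U_2;Y_2)+I(X_2;Y_3|U_2)$. * $\mathcal R_{(2),P}$: $R_1\le I(X_1;Y_1|U_1)$, $R_2\le I(U_1;Y_2|U_2)$, $R_3\le I(X_2;Y_3)$, $R_2+R_3\le I(U_1,U_2;Y_2)+I(X_2;Y_3|U_2)$.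 Let $\mathcal R_i=\bigcup_{P\in\mathcal P'}\mathcal R_{i,P}$ and $\mathcal R_{(i)}=\bigcup_{P\in\mathcal P'}\mathcal R_{(i),P}$ for $i=1,2$. Then $$Y_1\prec_o Y_2\ \Longrightarrow\ \mathcal R_1=\mathcal R_{(1)},\qquad\qquad Y_1\succ_c Y_2\ \Longrightarrow\ \mathcal R_2=\mathcal R_{(2)}.$$ -/

import Mathlib

noncomputable section

namespace BIC

/-! ### Information measures on a finite probability space (logarithms to base 2) -/

section Information

variable {Ω α β γ : Type*} [Fintype Ω] [Fintype α] [Fintype β] [Fintype γ]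

open scoped Classical in
/-- The law of the random variable `X` when `p` is the probability mass function on `Ω`:
`law p X a = Pr(X = a)`. -/
def law (p : Ω → ℝ) (X : Ω → α) (a : α) : ℝ := ∑ ω, if X ω = a then p ω else 0

/-- Shannon entropy `H(X) = -∑ₐ Pr(X = a) log₂ Pr(X = a)`, with `0 log 0 = 0`. -/
def entropy (p : Ω → ℝ) (X : Ω → α) : ℝ := ∑ a, Real.negMulLog (law p X a) / Real.log 2

/-- Conditional entropy `H(X | Y) = H(X, Y) - H(Y)`. -/
def condEntropy (p : Ω → ℝ) (X : Ω → α) (Y : Ω → β) : ℝ :=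
  entropy p (fun ω => (X ω, Y ω)) - entropy p Y

/-- Mutual information `I(X ; Y) = H(X) - H(X | Y)`. -/
def mutualInfo (p : Ω → ℝ) (X : Ω → α) (Y : Ω → β) : ℝ :=
  entropy p X - condEntropy p X Y

/-- Conditional mutual information `I(X ; Y | Z) = H(X | Z) - H(X | Y, Z)`. -/
def condMutualInfo (p : Ω → ℝ) (X : Ω → α) (Y : Ω → β) (Z : Ω → γ) : ℝ :=
  condEntropy p X Z - condEntropy p X (fun ω => (Y ω, Z ω))

end Information

/-! ### The channel -/

/-- A discrete memoryless broadcast interference channel with finite alphabets: the transition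
probability is `p(y₁, y₂, y₃ | x₁, x₂) = p(y₁ | x₁) p(y₂ | x₁, x₂) p(y₃ | x₂)`. -/
structure Channel (𝒳₁ 𝒳₂ 𝒴₁ 𝒴₂ 𝒴₃ : Type*) [Fintype 𝒴₁] [Fintype 𝒴₂] [Fintype 𝒴₃] where
  /-- `p(y₁ | x₁)` -/
  W₁ : 𝒳₁ → stdSimplex ℝ 𝒴₁
  /-- `p(y₂ | x₁, x₂)` -/
  W₂ : 𝒳₁ → 𝒳₂ → stdSimplex ℝ 𝒴₂
  /-- `p(y₃ | x₂)` -/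
  W₃ : 𝒳₂ → stdSimplex ℝ 𝒴₃

/-- The input distributions
`P(u₁, x₁, u₂, x₂) = P(u₁) P(x₁ | u₁) P(u₂) P(x₂ | u₂)`. -/
structure InputDist (𝒰₁ 𝒳₁ 𝒰₂ 𝒳₂ : Type*)
    [Fintype 𝒰₁] [Fintype 𝒳₁] [Fintype 𝒰₂] [Fintype 𝒳₂] where
  /-- `P(u₁)` -/
  pU₁ : stdSimplex ℝ 𝒰₁
  /-- `P(x₁ | u₁)` -/
  pX₁ : 𝒰₁ → stdSimplex ℝ 𝒳₁
  /-- `P(u₂)` -/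
  pU₂ : stdSimplex ℝ 𝒰₂
  /-- `P(x₂ | u₂)` -/
  pX₂ : 𝒰₂ → stdSimplex ℝ 𝒳₂

/-- An outcome of all the random variables `U₁, X₁, U₂, X₂, Y₁, Y₂, Y₃`. -/
abbrev Outcome (𝒰₁ 𝒳₁ 𝒰₂ 𝒳₂ 𝒴₁ 𝒴₂ 𝒴₃ : Type*) := 𝒰₁ × 𝒳₁ × 𝒰₂ × 𝒳₂ × 𝒴₁ × 𝒴₂ × 𝒴₃

section Coordinates

variable {𝒰₁ 𝒳₁ 𝒰₂ 𝒳₂ 𝒴₁ 𝒴₂ 𝒴₃ : Type*}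

/-- The random variable `U₁`. -/
def U₁ (ω : Outcome 𝒰₁ 𝒳₁ 𝒰₂ 𝒳₂ 𝒴₁ 𝒴₂ 𝒴₃) : 𝒰₁ := ω.1
/-- The random variable `X₁`. -/
def X₁ (ω : Outcome 𝒰₁ 𝒳₁ 𝒰₂ 𝒳₂ 𝒴₁ 𝒴₂ 𝒴₃) : 𝒳₁ := ω.2.1
/-- The random variable `U₂`. -/
def U₂ (ω : Outcome 𝒰₁ 𝒳₁ 𝒰₂ 𝒳₂ 𝒴₁ 𝒴₂ 𝒴₃) : 𝒰₂ := ω.2.2.1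
/-- The random variable `X₂`. -/
def X₂ (ω : Outcome 𝒰₁ 𝒳₁ 𝒰₂ 𝒳₂ 𝒴₁ 𝒴₂ 𝒴₃) : 𝒳₂ := ω.2.2.2.1
/-- The random variable `Y₁`. -/
def Y₁ (ω : Outcome 𝒰₁ 𝒳₁ 𝒰₂ 𝒳₂ 𝒴₁ 𝒴₂ 𝒴₃) : 𝒴₁ := ω.2.2.2.2.1
/-- The random variable `Y₂`. -/
def Y₂ (ω : Outcome 𝒰₁ 𝒳₁ 𝒰₂ 𝒳₂ 𝒴₁ 𝒴₂ 𝒴₃) : 𝒴₂ := ω.2.2.2.2.2.1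
/-- The random variable `Y₃`. -/
def Y₃ (ω : Outcome 𝒰₁ 𝒳₁ 𝒰₂ 𝒳₂ 𝒴₁ 𝒴₂ 𝒴₃) : 𝒴₃ := ω.2.2.2.2.2.2

end Coordinates

section Regions

variable {𝒰₁ 𝒳₁ 𝒰₂ 𝒳₂ 𝒴₁ 𝒴₂ 𝒴₃ : Type*} [Fintype 𝒰₁] [Fintype 𝒳₁] [Fintype 𝒰₂] [Fintype 𝒳₂]
  [Fintype 𝒴₁] [Fintype 𝒴₂] [Fintype 𝒴₃]

/-- The joint probability mass function of `(U₁, X₁, U₂, X₂, Y₁, Y₂, Y₃)` when the input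
distribution `P` is used over the channel `W`. -/
def joint (W : Channel 𝒳₁ 𝒳₂ 𝒴₁ 𝒴₂ 𝒴₃) (P : InputDist 𝒰₁ 𝒳₁ 𝒰₂ 𝒳₂) :
    Outcome 𝒰₁ 𝒳₁ 𝒰₂ 𝒳₂ 𝒴₁ 𝒴₂ 𝒴₃ → ℝ :=
  fun (u₁, x₁, u₂, x₂, y₁, y₂, y₃) =>
    P.pU₁ u₁ * P.pX₁ u₁ x₁ * P.pU₂ u₂ * P.pX₂ u₂ x₂ *
      (W.W₁ x₁ y₁ * W.W₂ x₁ x₂ y₂ * W.W₃ x₂ y₃)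

/-! ### The two partial-order broadcast conditions -/

/-- The joint probability mass function `p(u₁, x₁) p(x₂) p(y₁ | x₁) p(y₂ | x₁, x₂)` of
`(U₁, X₁, X₂, Y₁, Y₂)`. -/
def broadcastJoint (W : Channel 𝒳₁ 𝒳₂ 𝒴₁ 𝒴₂ 𝒴₃)
    (p : stdSimplex ℝ (𝒰₁ × 𝒳₁)) (q : stdSimplex ℝ 𝒳₂) :
    𝒰₁ × 𝒳₁ × 𝒳₂ × 𝒴₁ × 𝒴₂ → ℝ :=
  fun (u₁, x₁, x₂, y₁, y₂) => p (u₁, x₁) * q x₂ * (W.W₁ x₁ y₁ * W.W₂ x₁ x₂ y₂)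

/-- `Y₁ ≺ₒ Y₂`: receiver 2 is interference-oblivious less noisy than receiver 1, that is,
`I(U₁; Y₁) ≤ I(U₁; Y₂)` for every finite alphabet of `U₁` and all `p(u₁, x₁) p(x₂)`. -/
def ObliviousLessNoisy (W : Channel 𝒳₁ 𝒳₂ 𝒴₁ 𝒴₂ 𝒴₃) : Prop :=
  ∀ (𝒰 : Type) [Fintype 𝒰] (p : stdSimplex ℝ (𝒰 × 𝒳₁)) (q : stdSimplex ℝ 𝒳₂),
    mutualInfo (broadcastJoint W p q) (fun (u₁, _, _, _, _) => u₁) (fun (_, _, _, y₁, _) => y₁) ≤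
      mutualInfo (broadcastJoint W p q) (fun (u₁, _, _, _, _) => u₁) (fun (_, _, _, _, y₂) => y₂)

/-- `Y₁ ≻_c Y₂`: receiver 1 is interference-cognizant less noisy than receiver 2, that is,
`I(U₁; Y₁) ≥ I(U₁; Y₂ | X₂)` for every finite alphabet of `U₁` and all `p(u₁, x₁) p(x₂)`. -/
def CognizantLessNoisy (W : Channel 𝒳₁ 𝒳₂ 𝒴₁ 𝒴₂ 𝒴₃) : Prop :=
  ∀ (𝒰 : Type) [Fintype 𝒰] (p : stdSimplex ℝ (𝒰 × 𝒳₁)) (q : stdSimplex ℝ 𝒳₂),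
    mutualInfo (broadcastJoint W p q) (fun (u₁, _, _, _, _) => u₁) (fun (_, _, _, y₁, _) => y₁) ≥
      condMutualInfo (broadcastJoint W p q) (fun (u₁, _, _, _, _) => u₁)
        (fun (_, _, _, _, y₂) => y₂) (fun (_, _, x₂, _, _) => x₂)

/-! ### The regions for a fixed input distribution -/

/-- `𝓡_{1,P}`: split messages and superposition, cloud centre for receiver 1. -/
def splitRegion₁At (W : Channel 𝒳₁ 𝒳₂ 𝒴₁ 𝒴₂ 𝒴₃) (P : InputDist 𝒰₁ 𝒳₁ 𝒰₂ 𝒳₂) :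
    Set (ℝ × ℝ × ℝ) :=
  let p := joint W P
  {(R₁, R₂, R₃) | 0 ≤ R₁ ∧ 0 ≤ R₂ ∧ 0 ≤ R₃ ∧
    R₁ ≤ mutualInfo p U₁ Y₁ ∧
    R₃ ≤ mutualInfo p X₂ Y₃ ∧
    R₁ + R₂ ≤ mutualInfo p U₁ Y₁ + condMutualInfo p X₁ Y₂ (fun ω => (U₁ ω, U₂ ω)) ∧
    R₁ + R₂ + R₃ ≤ mutualInfo p U₁ Y₁ + condMutualInfo p (fun ω => (X₁ ω, U₂ ω)) Y₂ U₁ +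
      condMutualInfo p X₂ Y₃ U₂}

/-- `𝓡_{2,P}`: split messages and superposition, cloud centre for receiver 2. -/
def splitRegion₂At (W : Channel 𝒳₁ 𝒳₂ 𝒴₁ 𝒴₂ 𝒴₃) (P : InputDist 𝒰₁ 𝒳₁ 𝒰₂ 𝒳₂) :
    Set (ℝ × ℝ × ℝ) :=
  let p := joint W P
  {(R₁, R₂, R₃) | 0 ≤ R₁ ∧ 0 ≤ R₂ ∧ 0 ≤ R₃ ∧
    R₂ ≤ condMutualInfo p U₁ Y₂ U₂ ∧
    R₃ ≤ mutualInfo p X₂ Y₃ ∧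
    R₁ + R₂ ≤ condMutualInfo p X₁ Y₁ U₁ + condMutualInfo p U₁ Y₂ U₂ ∧
    R₂ + R₃ ≤ mutualInfo p (fun ω => (U₁ ω, U₂ ω)) Y₂ + condMutualInfo p X₂ Y₃ U₂ ∧
    R₁ + R₂ + R₃ ≤ condMutualInfo p X₁ Y₁ U₁ + mutualInfo p (fun ω => (U₁ ω, U₂ ω)) Y₂ +
      condMutualInfo p X₂ Y₃ U₂}

/-- `𝓡_{(1),P}`: superposition only, the cloud centre carries receiver 1's message. -/
def superpositionRegion₁At (W : Channel 𝒳₁ 𝒳₂ 𝒴₁ 𝒴₂ 𝒴₃) (P : InputDist 𝒰₁ 𝒳₁ 𝒰₂ 𝒳₂) :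
    Set (ℝ × ℝ × ℝ) :=
  let p := joint W P
  {(R₁, R₂, R₃) | 0 ≤ R₁ ∧ 0 ≤ R₂ ∧ 0 ≤ R₃ ∧
    R₁ ≤ mutualInfo p U₁ Y₁ ∧
    R₂ ≤ condMutualInfo p X₁ Y₂ (fun ω => (U₁ ω, U₂ ω)) ∧
    R₃ ≤ mutualInfo p X₂ Y₃ ∧
    R₂ + R₃ ≤ condMutualInfo p (fun ω => (X₁ ω, U₂ ω)) Y₂ U₁ + condMutualInfo p X₂ Y₃ U₂}

/-- `𝓡_{(2),P}`: superposition only, the cloud centre carries receiver 2's message. -/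
def superpositionRegion₂At (W : Channel 𝒳₁ 𝒳₂ 𝒴₁ 𝒴₂ 𝒴₃) (P : InputDist 𝒰₁ 𝒳₁ 𝒰₂ 𝒳₂) :
    Set (ℝ × ℝ × ℝ) :=
  let p := joint W P
  {(R₁, R₂, R₃) | 0 ≤ R₁ ∧ 0 ≤ R₂ ∧ 0 ≤ R₃ ∧
    R₁ ≤ condMutualInfo p X₁ Y₁ U₁ ∧
    R₂ ≤ condMutualInfo p U₁ Y₂ U₂ ∧
    R₃ ≤ mutualInfo p X₂ Y₃ ∧
    R₂ + R₃ ≤ mutualInfo p (fun ω => (U₁ ω, U₂ ω)) Y₂ + condMutualInfo p X₂ Y₃ U₂}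

/-! ### The regions: unions over all finite auxiliary alphabets and all input distributions -/

/-- `𝓡₁ = ⋃_P 𝓡_{1,P}`. -/
def splitRegion₁ (W : Channel 𝒳₁ 𝒳₂ 𝒴₁ 𝒴₂ 𝒴₃) : Set (ℝ × ℝ × ℝ) :=
  {R | ∃ (𝒰₁ 𝒰₂ : Type) (_ : Fintype 𝒰₁) (_ : Fintype 𝒰₂) (P : InputDist 𝒰₁ 𝒳₁ 𝒰₂ 𝒳₂),
    R ∈ splitRegion₁At W P}

/-- `𝓡₂ = ⋃_P 𝓡_{2,P}`. -/
def splitRegion₂ (W : Channel 𝒳₁ 𝒳₂ 𝒴₁ 𝒴₂ 𝒴₃) : Set (ℝ × ℝ × ℝ) :=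
  {R | ∃ (𝒰₁ 𝒰₂ : Type) (_ : Fintype 𝒰₁) (_ : Fintype 𝒰₂) (P : InputDist 𝒰₁ 𝒳₁ 𝒰₂ 𝒳₂),
    R ∈ splitRegion₂At W P}

/-- `𝓡₍₁₎ = ⋃_P 𝓡_{(1),P}`. -/
def superpositionRegion₁ (W : Channel 𝒳₁ 𝒳₂ 𝒴₁ 𝒴₂ 𝒴₃) : Set (ℝ × ℝ × ℝ) :=
  {R | ∃ (𝒰₁ 𝒰₂ : Type) (_ : Fintype 𝒰₁) (_ : Fintype 𝒰₂) (P : InputDist 𝒰₁ 𝒳₁ 𝒰₂ 𝒳₂),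
    R ∈ superpositionRegion₁At W P}

/-- `𝓡₍₂₎ = ⋃_P 𝓡_{(2),P}`. -/
def superpositionRegion₂ (W : Channel 𝒳₁ 𝒳₂ 𝒴₁ 𝒴₂ 𝒴₃) : Set (ℝ × ℝ × ℝ) :=
  {R | ∃ (𝒰₁ 𝒰₂ : Type) (_ : Fintype 𝒰₁) (_ : Fintype 𝒰₂) (P : InputDist 𝒰₁ 𝒳₁ 𝒰₂ 𝒳₂),
    R ∈ superpositionRegion₂At W P}

end Regions

end BIC

end

/-!
Given `P` and a rate triple in `𝓡_{i,P}`, replace `U₁` by the output of an erasure channel with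
input `U₁` and erasure probability `ε`. The law of all other variables is unchanged and the new
distribution is still admissible. Every information about `U₁` is multiplied by `1 - ε`, and by the
chain rule the missing fraction `ε` is added to the information that `X₁` carries beyond `U₁`.

For `𝓡₁`, choose `ε` so that `R₁` equals the new `I(U₁; Y₁)`. The bounds on the other receivers
then gain `ε I(U₁; Y₂ | U₂)` and `ε I(U₁; Y₂)`, and both are at least `ε I(U₁; Y₁)`, by the less
noisy condition and because `U₁` and `U₂` are independent. For `𝓡₂`, choose `ε` so that
`ε I(U₁; Y₂ | U₂)` is the excess, if any, of `R₁` over `I(X₁; Y₁ | U₁)`. The bounds on `R₂` and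
`R₂ + R₃` drop by this excess, as the sum-rate bounds allow, while the bound on `R₁` gains
`ε I(U₁; Y₁)`, which covers the excess because `I(U₁; Y₂ | U₂) ≤ I(U₁; Y₂ | X₂) ≤ I(U₁; Y₁)`.
-/

noncomputable section

namespace BIC

section Law

variable {Ω α β : Type*} [Fintype Ω] {p : Ω → ℝ}

theorem law_nonneg (hp : ∀ ω, 0 ≤ p ω) (X : Ω → α) (a : α) : 0 ≤ law p X a :=
  Finset.sum_nonneg fun ω _ => by split_ifs <;> simp [hp ω]

theorem law_mono (hp : ∀ ω, 0 ≤ p ω) {X : Ω → α} {Y : Ω → β} {a : α} {b : β}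
    (h : ∀ ω, X ω = a → Y ω = b) : law p X a ≤ law p Y b :=
  Finset.sum_le_sum fun ω _ => by
    by_cases hX : X ω = a
    · simp [hX, h ω hX]
    · rw [if_neg hX]
      split_ifs <;> simp [hp ω]

theorem law_congr (p : Ω → ℝ) {X : Ω → α} {Y : Ω → β} {a : α} {b : β}
    (h : ∀ ω, X ω = a ↔ Y ω = b) : law p X a = law p Y b := by
  classical
  exact Finset.sum_congr rfl fun ω _ => if_congr (h ω) rfl rfl

theorem law_id (p : Ω → ℝ) : law p id = p := by
  classical
  funext ω
  simp [law]

theorem sum_law_mul [Fintype α] (p : Ω → ℝ) (X : Ω → α) (g : α → ℝ) :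
    ∑ a, law p X a * g a = ∑ ω, p ω * g (X ω) := by
  classical
  simp only [law, Finset.sum_mul, ite_mul, zero_mul]
  rw [Finset.sum_comm]
  simp

theorem sum_law [Fintype α] (p : Ω → ℝ) (X : Ω → α) : ∑ a, law p X a = ∑ ω, p ω := by
  simpa using sum_law_mul p X 1

theorem sum_law_prod [Fintype α] (p : Ω → ℝ) (X : Ω → α) (Y : Ω → β) (b : β) :
    ∑ a, law p (fun ω => (X ω, Y ω)) (a, b) = law p Y b := by
  classical
  simp only [law]
  rw [Finset.sum_comm]
  simp [ite_and]

theorem law_eq_sum [Fintype α] (p : Ω → ℝ) (X : Ω → α) {Y : Ω → β} {b : β} {f : α → Ω}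
    (hf : ∀ ω a, X ω = a ∧ Y ω = b ↔ ω = f a) : law p Y b = ∑ a, p (f a) := by
  rw [← sum_law_prod p X]
  refine Finset.sum_congr rfl fun a _ => ?_
  rw [law_congr (Y := id) (b := f a) p fun ω => Prod.mk.injEq .. ▸ hf ω a, law_id]

theorem law_law [Fintype α] (p : Ω → ℝ) (X : Ω → α) (f : α → β) (b : β) :
    law (law p X) f b = law p (fun ω => f (X ω)) b := by
  classical
  simpa only [law, mul_ite, mul_one, mul_zero] using
    sum_law_mul p X fun a => if f a = b then 1 else 0

end Law

section Entropy

variable {Ω α β γ δ : Type*} [Fintype Ω] [Fintype α] [Fintype β] [Fintype γ] [Fintype δ]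

theorem entropy_law (p : Ω → ℝ) (X : Ω → α) (f : α → β) :
    entropy (law p X) f = entropy p (fun ω => f (X ω)) := by
  simp only [entropy, law_law]

theorem mutualInfo_law (p : Ω → ℝ) (X : Ω → α) (f : α → β) (g : α → γ) :
    mutualInfo (law p X) f g = mutualInfo p (fun ω => f (X ω)) (fun ω => g (X ω)) := by
  simp only [mutualInfo, condEntropy, entropy_law]

theorem condMutualInfo_law (p : Ω → ℝ) (X : Ω → α) (f : α → β) (g : α → γ) (h : α → δ) :
    condMutualInfo (law p X) f g h =
      condMutualInfo p (fun ω => f (X ω)) (fun ω => g (X ω)) (fun ω => h (X ω)) := by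
  simp only [condMutualInfo, condEntropy, entropy_law]

theorem entropy_eq_sum (p : Ω → ℝ) (X : Ω → α) :
    entropy p X = (∑ ω, p ω * -Real.log (law p X (X ω))) / Real.log 2 := by
  rw [← sum_law_mul p X fun a => -Real.log (law p X a), Finset.sum_div]
  simp only [entropy, Real.negMulLog, mul_neg, neg_mul]

theorem entropy_congr (p : Ω → ℝ) {X : Ω → α} {Y : Ω → β}
    (h : ∀ ω ω', X ω = X ω' ↔ Y ω = Y ω') : entropy p X = entropy p Y := by
  simp only [entropy_eq_sum, law_congr p fun ω => h ω _]

theorem entropy_const {p : Ω → ℝ} (hp : ∑ ω, p ω = 1) : entropy p (fun _ => ()) = 0 := by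
  simp [entropy, law, hp]

theorem mutualInfo_eq_condMutualInfo_const {p : Ω → ℝ} (hp : ∑ ω, p ω = 1)
    (X : Ω → α) (Y : Ω → β) : mutualInfo p X Y = condMutualInfo p X Y (fun _ => ()) := by
  have hX : entropy p (fun ω => (X ω, ())) = entropy p X := entropy_congr p (by grind)
  have hY : entropy p (fun ω => (Y ω, ())) = entropy p Y := entropy_congr p (by grind)
  have hXY : entropy p (fun ω => (X ω, Y ω, ())) = entropy p (fun ω => (X ω, Y ω)) :=
    entropy_congr p (by grind)
  simp only [mutualInfo, condMutualInfo, condEntropy, hX, hY, hXY, entropy_const hp, sub_zero]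

end Entropy

section Nonneg

theorem sub_le_mul_log_sub_log {x y : ℝ} (hx : 0 ≤ x) (hy : 0 ≤ y) (hxy : y = 0 → x = 0) :
    x - y ≤ x * (Real.log x - Real.log y) := by
  rcases hx.eq_or_lt with rfl | hx'
  · simpa using hy
  have hy' : 0 < y := hy.lt_of_ne' (mt hxy hx'.ne')
  calc x - y = x * (1 - (x / y)⁻¹) := by field_simp
    _ ≤ x * Real.log (x / y) :=
      mul_le_mul_of_nonneg_left (Real.one_sub_inv_le_log_of_pos (div_pos hx' hy')) hx
    _ = x * (Real.log x - Real.log y) := by rw [Real.log_div hx'.ne' hy'.ne']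

theorem sum_mul_log_sub_log_nonneg {ι : Type*} [Fintype ι] {p q : ι → ℝ} (hp : ∀ i, 0 ≤ p i)
    (hq : ∀ i, 0 ≤ q i) (hpq : ∀ i, q i = 0 → p i = 0) (hsum : ∑ i, q i ≤ ∑ i, p i) :
    0 ≤ ∑ i, p i * (Real.log (p i) - Real.log (q i)) :=
  calc 0 ≤ ∑ i, (p i - q i) := by rwa [Finset.sum_sub_distrib, sub_nonneg]
    _ ≤ ∑ i, p i * (Real.log (p i) - Real.log (q i)) :=
      Finset.sum_le_sum fun i _ => sub_le_mul_log_sub_log (hp i) (hq i) (hpq i)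

variable {Ω α β γ : Type*} [Fintype Ω] {p : Ω → ℝ}

/-- The law that makes `X` and `Y` conditionally independent given `Z`, with the same laws of
`(X, Z)` and `(Y, Z)`; where `Pr(Z = c) = 0` the division gives the correct value `0`. -/
def condProdLaw (p : Ω → ℝ) (X : Ω → α) (Y : Ω → β) (Z : Ω → γ) (t : α × β × γ) : ℝ :=
  law p (fun ω => (X ω, Z ω)) (t.1, t.2.2) * law p (fun ω => (Y ω, Z ω)) t.2 / law p Z t.2.2

theorem condProdLaw_nonneg (hp : ∀ ω, 0 ≤ p ω) (X : Ω → α) (Y : Ω → β) (Z : Ω → γ)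
    (t : α × β × γ) : 0 ≤ condProdLaw p X Y Z t :=
  div_nonneg (mul_nonneg (law_nonneg hp _ _) (law_nonneg hp _ _)) (law_nonneg hp _ _)

theorem law_eq_zero_of_condProdLaw_eq_zero (hp : ∀ ω, 0 ≤ p ω) {X : Ω → α} {Y : Ω → β}
    {Z : Ω → γ} {t : α × β × γ} (h : condProdLaw p X Y Z t = 0) :
    law p (fun ω => (X ω, Y ω, Z ω)) t = 0 := by
  refine le_antisymm ?_ (law_nonneg hp _ _)
  rcases div_eq_zero_iff.1 h with hXYZ | hZ
  · rcases mul_eq_zero.1 hXYZ with hXZ | hYZ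
    · exact hXZ ▸ law_mono hp (by grind)
    · exact hYZ ▸ law_mono hp (by grind)
  · exact hZ ▸ law_mono hp (by grind)

variable [Fintype α] [Fintype β] [Fintype γ]

theorem sum_condProdLaw (p : Ω → ℝ) (X : Ω → α) (Y : Ω → β) (Z : Ω → γ) :
    ∑ t, condProdLaw p X Y Z t = ∑ ω, p ω := by
  calc ∑ t, condProdLaw p X Y Z t
      = ∑ c, (∑ a, law p (fun ω => (X ω, Z ω)) (a, c)) *
          (∑ b, law p (fun ω => (Y ω, Z ω)) (b, c)) / law p Z c := by
        simp only [condProdLaw, Fintype.sum_prod_type_right, Finset.sum_mul_sum, Finset.sum_div]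
        exact Finset.sum_congr rfl fun c _ => Finset.sum_comm
    _ = ∑ c, law p Z c := by simp only [sum_law_prod, mul_self_div_self]
    _ = ∑ ω, p ω := sum_law p Z

theorem condMutualInfo_eq_sum_log_sub_log (hp : ∀ ω, 0 ≤ p ω) (X : Ω → α) (Y : Ω → β)
    (Z : Ω → γ) :
    condMutualInfo p X Y Z =
      (∑ t, law p (fun ω => (X ω, Y ω, Z ω)) t *
        (Real.log (law p (fun ω => (X ω, Y ω, Z ω)) t) -
          Real.log (condProdLaw p X Y Z t))) / Real.log 2 := by
  have hlog (t : α × β × γ) (ht : law p (fun ω => (X ω, Y ω, Z ω)) t ≠ 0) :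
      Real.log (condProdLaw p X Y Z t) =
        Real.log (law p (fun ω => (X ω, Z ω)) (t.1, t.2.2)) +
          Real.log (law p (fun ω => (Y ω, Z ω)) t.2) - Real.log (law p Z t.2.2) := by
    have hne := mt (law_eq_zero_of_condProdLaw_eq_zero hp) ht
    simp only [condProdLaw, div_eq_zero_iff, mul_eq_zero, not_or] at hne
    rw [condProdLaw, Real.log_div (mul_ne_zero hne.1.1 hne.1.2) hne.2,
      Real.log_mul hne.1.1 hne.1.2]
  calc condMutualInfo p X Y Z
      = (∑ t, law p (fun ω => (X ω, Y ω, Z ω)) t *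
          (Real.log (law p (fun ω => (X ω, Y ω, Z ω)) t) -
            (Real.log (law p (fun ω => (X ω, Z ω)) (t.1, t.2.2)) +
              Real.log (law p (fun ω => (Y ω, Z ω)) t.2) - Real.log (law p Z t.2.2)))) /
          Real.log 2 := by
        simp only [sum_law_mul, condMutualInfo, condEntropy, entropy_eq_sum, ← sub_div,
          ← Finset.sum_sub_distrib]
        congr! 2
        ring
    _ = _ := by
        congr! 2 with t
        rcases eq_or_ne (law p (fun ω => (X ω, Y ω, Z ω)) t) 0 with ht | ht
        · simp only [ht, zero_mul]
        · rw [hlog t ht]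

theorem condMutualInfo_nonneg (hp : ∀ ω, 0 ≤ p ω) (X : Ω → α) (Y : Ω → β) (Z : Ω → γ) :
    0 ≤ condMutualInfo p X Y Z := by
  rw [condMutualInfo_eq_sum_log_sub_log hp]
  refine div_nonneg ?_ (Real.log_nonneg one_le_two)
  refine sum_mul_log_sub_log_nonneg (law_nonneg hp _) (condProdLaw_nonneg hp X Y Z)
    (fun t => law_eq_zero_of_condProdLaw_eq_zero hp) ?_
  rw [sum_condProdLaw, sum_law]

theorem condMutualInfo_eq_zero_of_law_eq_mul (hp : ∀ ω, 0 ≤ p ω) {X : Ω → α} {Y : Ω → β}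
    {Z : Ω → γ} {f : α → γ → ℝ} {g : β → γ → ℝ}
    (h : ∀ a b c, law p (fun ω => (X ω, Y ω, Z ω)) (a, b, c) = f a c * g b c) :
    condMutualInfo p X Y Z = 0 := by
  have hYZ (b : β) (c : γ) : law p (fun ω => (Y ω, Z ω)) (b, c) = (∑ a, f a c) * g b c := by
    rw [← sum_law_prod p X, Finset.sum_mul]
    exact Finset.sum_congr rfl fun a _ => h a b c
  have hXZ (a : α) (c : γ) : law p (fun ω => (X ω, Z ω)) (a, c) = f a c * ∑ b, g b c := by
    rw [← sum_law_prod p Y, Finset.mul_sum]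
    exact Finset.sum_congr rfl fun b _ => (law_congr p (by grind)).trans (h a b c)
  have hZ (c : γ) : law p Z c = (∑ a, f a c) * ∑ b, g b c := by
    rw [← sum_law_prod p Y, Finset.mul_sum]
    exact Finset.sum_congr rfl fun b _ => hYZ b c
  have hprod (t : α × β × γ) :
      law p (fun ω => (X ω, Y ω, Z ω)) t = condProdLaw p X Y Z t := by
    obtain ⟨a, b, c⟩ := t
    by_cases hc : law p Z c = 0
    · have h0 : condProdLaw p X Y Z (a, b, c) = 0 := by simp only [condProdLaw, hc, div_zero]
      rw [h0, law_eq_zero_of_condProdLaw_eq_zero hp h0]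
    · rw [condProdLaw, eq_div_iff hc, h, hXZ, hYZ, hZ]
      ring
  simp only [condMutualInfo_eq_sum_log_sub_log hp, hprod, sub_self, mul_zero,
    Finset.sum_const_zero, zero_div]

theorem mutualInfo_nonneg (hp : p ∈ stdSimplex ℝ Ω) (X : Ω → α) (Y : Ω → β) :
    0 ≤ mutualInfo p X Y := by
  rw [mutualInfo_eq_condMutualInfo_const hp.2]
  exact condMutualInfo_nonneg hp.1 X Y _

theorem mutualInfo_eq_zero_of_law_eq_mul (hp : p ∈ stdSimplex ℝ Ω) {X : Ω → α} {Y : Ω → β}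
    {f : α → ℝ} {g : β → ℝ} (h : ∀ a b, law p (fun ω => (X ω, Y ω)) (a, b) = f a * g b) :
    mutualInfo p X Y = 0 := by
  rw [mutualInfo_eq_condMutualInfo_const hp.2]
  refine condMutualInfo_eq_zero_of_law_eq_mul hp.1 (f := fun a _ => f a) (g := fun b _ => g b) ?_
  intro a b c
  exact (law_congr p (by grind)).trans (h a b)

end Nonneg

section ChainRules

variable {Ω α β γ δ ε : Type*} [Fintype Ω] [Fintype α] [Fintype β] [Fintype γ] [Fintype δ]
  [Fintype ε] {p : Ω → ℝ}

theorem condMutualInfo_comm (p : Ω → ℝ) (X : Ω → α) (Y : Ω → β) (Z : Ω → γ) :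
    condMutualInfo p X Y Z = condMutualInfo p Y X Z := by
  have hXYZ : entropy p (fun ω => (X ω, Y ω, Z ω)) = entropy p (fun ω => (Y ω, X ω, Z ω)) :=
    entropy_congr p (by grind)
  simp only [condMutualInfo, condEntropy, hXYZ]
  ring

theorem mutualInfo_prod_right (p : Ω → ℝ) (X : Ω → α) (Y : Ω → β) (Z : Ω → γ) :
    mutualInfo p X (fun ω => (Y ω, Z ω)) = mutualInfo p X Z + condMutualInfo p X Y Z := by
  simp only [mutualInfo, condMutualInfo]
  ring

theorem mutualInfo_congr (p : Ω → ℝ) {X : Ω → α} {X' : Ω → β} {Y : Ω → γ} {Y' : Ω → δ}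
    (hX : ∀ ω ω', X ω = X ω' ↔ X' ω = X' ω') (hY : ∀ ω ω', Y ω = Y ω' ↔ Y' ω = Y' ω') :
    mutualInfo p X Y = mutualInfo p X' Y' := by
  have hXY : entropy p (fun ω => (X ω, Y ω)) = entropy p (fun ω => (X' ω, Y' ω)) :=
    entropy_congr p (by grind)
  simp only [mutualInfo, condEntropy, entropy_congr p hX, entropy_congr p hY, hXY]

theorem mutualInfo_prod_left (p : Ω → ℝ) (X : Ω → α) (Y : Ω → β) (Z : Ω → γ) :
    mutualInfo p (fun ω => (X ω, Y ω)) Z = mutualInfo p Y Z + condMutualInfo p X Z Y := by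
  have hXYZ : entropy p (fun ω => ((X ω, Y ω), Z ω)) = entropy p (fun ω => (X ω, Z ω, Y ω)) :=
    entropy_congr p (by grind)
  have hYZ : entropy p (fun ω => (Y ω, Z ω)) = entropy p (fun ω => (Z ω, Y ω)) :=
    entropy_congr p (by grind)
  simp only [mutualInfo, condMutualInfo, condEntropy, hXYZ, hYZ]
  ring

theorem mutualInfo_eq_add_condMutualInfo {X : Ω → α} {Y : Ω → β} {U : Ω → γ}
    (h : condMutualInfo p U Y X = 0) :
    mutualInfo p X Y = mutualInfo p U Y + condMutualInfo p X Y U := by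
  rw [← mutualInfo_prod_left, ← add_zero (mutualInfo p X Y), ← h, ← mutualInfo_prod_left]
  exact mutualInfo_congr p (by grind) (by grind)

theorem condMutualInfo_eq_add_condMutualInfo {X : Ω → α} {Y : Ω → β} {U : Ω → γ} {Z : Ω → δ}
    (h : condMutualInfo p U Y (fun ω => (X ω, Z ω)) = 0) :
    condMutualInfo p X Y Z =
      condMutualInfo p U Y Z + condMutualInfo p X Y (fun ω => (U ω, Z ω)) := by
  have hchain : mutualInfo p (fun ω => (U ω, X ω, Z ω)) Y =
      mutualInfo p (fun ω => (X ω, U ω, Z ω)) Y := mutualInfo_congr p (by grind) (by grind)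
  simp only [mutualInfo_prod_left, h] at hchain
  linarith

theorem mutualInfo_le_condMutualInfo (hp : ∀ ω, 0 ≤ p ω) {X : Ω → α} {Z : Ω → γ}
    (h : mutualInfo p X Z = 0) (Y : Ω → β) : mutualInfo p X Y ≤ condMutualInfo p X Y Z := by
  have hchain : mutualInfo p X (fun ω => (Y ω, Z ω)) = mutualInfo p X (fun ω => (Z ω, Y ω)) :=
    mutualInfo_congr p (by grind) (by grind)
  rw [mutualInfo_prod_right, mutualInfo_prod_right, h] at hchain
  linarith [condMutualInfo_nonneg hp X Z Y]

theorem condMutualInfo_le_condMutualInfo (hp : p ∈ stdSimplex ℝ Ω) {X : Ω → α} {Y : Ω → β}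
    {V : Ω → γ} {Z : Ω → δ} (hXZ : mutualInfo p X Z = 0)
    (hXV : condMutualInfo p X V (fun ω => (Y ω, Z ω)) = 0) :
    condMutualInfo p X Y V ≤ condMutualInfo p X Y Z := by
  have hchain : mutualInfo p X (fun ω => (Z ω, Y ω, V ω)) =
      mutualInfo p X (fun ω => (V ω, Y ω, Z ω)) := mutualInfo_congr p (by grind) (by grind)
  simp only [mutualInfo_prod_right, hXZ, hXV] at hchain
  linarith [mutualInfo_nonneg hp X V, condMutualInfo_nonneg hp.1 X Z (fun ω => (Y ω, V ω))]

theorem condMutualInfo_eq_zero_of_refines (hp : ∀ ω, 0 ≤ p ω) {X : Ω → α} {Y : Ω → β}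
    {Z : Ω → γ} (h : condMutualInfo p X Y Z = 0) {V : Ω → δ} {T : Ω → ε}
    (hT : ∀ ω ω', T ω = T ω' → Z ω = Z ω')
    (hYZ : ∀ ω ω', Y ω = Y ω' → Z ω = Z ω' → V ω = V ω' ∧ T ω = T ω') :
    condMutualInfo p X V T = 0 := by
  have hZ : mutualInfo p X (fun ω => (T ω, Z ω)) = mutualInfo p X T :=
    mutualInfo_congr p (by grind) (by grind)
  have hY : mutualInfo p X (fun ω => (Y ω, V ω, T ω)) = mutualInfo p X (fun ω => (Y ω, Z ω)) :=
    mutualInfo_congr p (by grind) (by grind)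
  simp only [mutualInfo_prod_right, h] at hZ hY
  linarith [condMutualInfo_nonneg hp X T Z, condMutualInfo_nonneg hp X V T,
    condMutualInfo_nonneg hp X Y (fun ω => (V ω, T ω))]

theorem mutualInfo_eq_zero_of_refines (hp : p ∈ stdSimplex ℝ Ω) {X : Ω → α} {Y : Ω → β}
    (h : mutualInfo p X Y = 0) {V : Ω → δ} (hV : ∀ ω ω', Y ω = Y ω' → V ω = V ω') :
    mutualInfo p X V = 0 := by
  have hY : mutualInfo p X (fun ω => (Y ω, V ω)) = mutualInfo p X Y :=
    mutualInfo_congr p (by grind) (by grind)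
  rw [mutualInfo_prod_right, h] at hY
  linarith [mutualInfo_nonneg hp X V, condMutualInfo_nonneg hp.1 X Y V]

end ChainRules

section Erasure

theorem sum_negMulLog_const_mul {ι : Type*} [Fintype ι] {q : ι → ℝ} (hq : ∑ i, q i = 1) (c : ℝ) :
    ∑ i, Real.negMulLog (c * q i) = Real.negMulLog c + c * ∑ i, Real.negMulLog (q i) := by
  simp only [Real.negMulLog_mul, Finset.sum_add_distrib, ← Finset.sum_mul, ← Finset.mul_sum, hq,
    one_mul]

variable {𝒰 Ω α β γ : Type*} [Fintype 𝒰] [Fintype Ω]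

/-- The probability mass function of `(U', ω)` when `(U, ω)` has probability mass function `p` and
`U'` is the output of an erasure channel with input `U` and erasure probability `ε`; the erasure
symbol is `none`. -/
def erase (ε : ℝ) (p : 𝒰 × Ω → ℝ) : Option 𝒰 × Ω → ℝ
  | (some u, ω) => (1 - ε) * p (u, ω)
  | (none, ω) => ε * ∑ u, p (u, ω)

theorem law_erase (ε : ℝ) (p : 𝒰 × Ω → ℝ) (X : Option 𝒰 × Ω → α) (a : α) :
    law (erase ε p) X a =
      (1 - ε) * law p (fun t => X (some t.1, t.2)) a + ε * law p (fun t => X (none, t.2)) a := by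
  classical
  have hnone : ∑ t : 𝒰 × Ω, (if X (none, t.2) = a then p t else 0) =
      ∑ ω, if X (none, ω) = a then ∑ u, p (u, ω) else 0 := by
    rw [Fintype.sum_prod_type_right]
    exact Finset.sum_congr rfl fun ω _ => by split_ifs <;> simp
  simp only [law, hnone, Fintype.sum_prod_type (γ := ℝ), Fintype.sum_option, erase, Finset.mul_sum,
    mul_ite, mul_zero]
  ring

theorem law_erase_some (ε : ℝ) (p : 𝒰 × Ω → ℝ) (Z : Ω → γ) (u : 𝒰) (c : γ) :
    law (erase ε p) (fun t => (t.1, Z t.2)) (some u, c) =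
      (1 - ε) * law p (fun t => (t.1, Z t.2)) (u, c) := by
  classical
  rw [law_erase]
  simp [law]

theorem law_erase_none (ε : ℝ) (p : 𝒰 × Ω → ℝ) (Z : Ω → γ) (c : γ) :
    law (erase ε p) (fun t => (t.1, Z t.2)) (none, c) = ε * law p (fun t => Z t.2) c := by
  classical
  rw [law_erase]
  simp [law]

theorem law_erase_comp_snd (ε : ℝ) (p : 𝒰 × Ω → ℝ) (Z : Ω → γ) (c : γ) :
    law (erase ε p) (fun t => Z t.2) c = law p (fun t => Z t.2) c := by
  rw [law_erase]
  ring

variable [Fintype α] [Fintype β] [Fintype γ]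

theorem entropy_erase_comp_snd (ε : ℝ) (p : 𝒰 × Ω → ℝ) (Z : Ω → γ) :
    entropy (erase ε p) (fun t => Z t.2) = entropy p (fun t => Z t.2) := by
  simp only [entropy, law_erase_comp_snd]

theorem entropy_erase {p : 𝒰 × Ω → ℝ} (hp : ∑ t, p t = 1) (ε : ℝ) (Z : Ω → γ) :
    entropy (erase ε p) (fun t => (t.1, Z t.2)) =
      (1 - ε) * entropy p (fun t => (t.1, Z t.2)) + ε * entropy p (fun t => Z t.2) +
        Real.binEntropy ε / Real.log 2 := by
  have hsplit (f : Option 𝒰 × γ → ℝ) :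
      ∑ x, f x = ∑ c, f (none, c) + ∑ x : 𝒰 × γ, f (some x.1, x.2) := by
    simp only [Fintype.sum_prod_type, Fintype.sum_option]
  simp only [entropy, ← Finset.sum_div, hsplit, law_erase_some, law_erase_none]
  rw [sum_negMulLog_const_mul ((sum_law p _).trans hp),
    sum_negMulLog_const_mul ((sum_law p _).trans hp),
    Real.binEntropy_eq_negMulLog_add_negMulLog_one_sub]
  ring

theorem sum_erase (ε : ℝ) (p : 𝒰 × Ω → ℝ) : ∑ t, erase ε p t = ∑ t, p t := by
  simpa [law] using law_erase_comp_snd ε p (fun _ => ()) ()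

theorem condMutualInfo_erase_fst {p : 𝒰 × Ω → ℝ} (hp : ∑ t, p t = 1) (ε : ℝ) (Y : Ω → β)
    (Z : Ω → γ) :
    condMutualInfo (erase ε p) (fun t => t.1) (fun t => Y t.2) (fun t => Z t.2) =
      (1 - ε) * condMutualInfo p (fun t => t.1) (fun t => Y t.2) (fun t => Z t.2) := by
  simp only [condMutualInfo, condEntropy, entropy_erase hp ε fun ω => (Y ω, Z ω),
    entropy_erase hp, entropy_erase_comp_snd ε p fun ω => (Y ω, Z ω), entropy_erase_comp_snd]
  ring

theorem mutualInfo_erase_fst {p : 𝒰 × Ω → ℝ} (hp : ∑ t, p t = 1) (ε : ℝ) (Y : Ω → β) :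
    mutualInfo (erase ε p) (fun t => t.1) (fun t => Y t.2) =
      (1 - ε) * mutualInfo p (fun t => t.1) (fun t => Y t.2) := by
  rw [mutualInfo_eq_condMutualInfo_const hp,
    mutualInfo_eq_condMutualInfo_const ((sum_erase ε p).trans hp)]
  exact condMutualInfo_erase_fst hp ε Y fun _ => ()

theorem mutualInfo_erase_comp_snd (ε : ℝ) (p : 𝒰 × Ω → ℝ) (X : Ω → α) (Y : Ω → β) :
    mutualInfo (erase ε p) (fun t => X t.2) (fun t => Y t.2) =
      mutualInfo p (fun t => X t.2) (fun t => Y t.2) := by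
  simp only [mutualInfo, condEntropy, entropy_erase_comp_snd ε p fun ω => (X ω, Y ω),
    entropy_erase_comp_snd]

theorem condMutualInfo_erase_comp_snd (ε : ℝ) (p : 𝒰 × Ω → ℝ) (X : Ω → α) (Y : Ω → β)
    (Z : Ω → γ) :
    condMutualInfo (erase ε p) (fun t => X t.2) (fun t => Y t.2) (fun t => Z t.2) =
      condMutualInfo p (fun t => X t.2) (fun t => Y t.2) (fun t => Z t.2) := by
  simp only [condMutualInfo, condEntropy, entropy_erase_comp_snd ε p fun ω => (X ω, Z ω),
    entropy_erase_comp_snd ε p fun ω => (Y ω, Z ω),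
    entropy_erase_comp_snd ε p fun ω => (X ω, Y ω, Z ω), entropy_erase_comp_snd]

end Erasure

section Joint

/-- The law of the output of the kernel `k` when its input has law `p`. -/
def mixture {𝒰 𝒳 : Type*} [Fintype 𝒰] [Fintype 𝒳] (p : stdSimplex ℝ 𝒰)
    (k : 𝒰 → stdSimplex ℝ 𝒳) : stdSimplex ℝ 𝒳 :=
  ⟨∑ u, p u • ⇑(k u),
    (convex_stdSimplex ℝ 𝒳).sum_mem (fun u _ => p.2.1 u) p.2.2 fun u _ => (k u).2⟩

/-- The joint law `p(u) k(x | u)` of the input and the output of the kernel `k`. -/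
def compProd {𝒰 𝒳 : Type*} [Fintype 𝒰] [Fintype 𝒳] (p : stdSimplex ℝ 𝒰)
    (k : 𝒰 → stdSimplex ℝ 𝒳) : stdSimplex ℝ (𝒰 × 𝒳) :=
  ⟨fun t => p t.1 * k t.1 t.2, fun t => mul_nonneg (p.2.1 t.1) ((k t.1).2.1 t.2), by
    simp [Fintype.sum_prod_type, ← Finset.mul_sum]⟩

theorem mixture_apply {𝒰 𝒳 : Type*} [Fintype 𝒰] [Fintype 𝒳] (p : stdSimplex ℝ 𝒰)
    (k : 𝒰 → stdSimplex ℝ 𝒳) (x : 𝒳) : mixture p k x = ∑ u, p u * k u x := by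
  change (∑ u, p u • ⇑(k u)) x = _
  simp only [Finset.sum_apply, Pi.smul_apply, smul_eq_mul]

variable {𝒰₁ 𝒳₁ 𝒰₂ 𝒳₂ 𝒴₁ 𝒴₂ 𝒴₃ : Type*}

theorem outcome_eq_iff {ω : Outcome 𝒰₁ 𝒳₁ 𝒰₂ 𝒳₂ 𝒴₁ 𝒴₂ 𝒴₃} {u₁ x₁ u₂ x₂ y₁ y₂ y₃} :
    ω = (u₁, x₁, u₂, x₂, y₁, y₂, y₃) ↔ U₁ ω = u₁ ∧ X₁ ω = x₁ ∧ U₂ ω = u₂ ∧ X₂ ω = x₂ ∧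
      Y₁ ω = y₁ ∧ Y₂ ω = y₂ ∧ Y₃ ω = y₃ := by
  simp only [Prod.ext_iff, U₁, X₁, U₂, X₂, Y₁, Y₂, Y₃]

variable [Fintype 𝒰₁] [Fintype 𝒳₁] [Fintype 𝒰₂] [Fintype 𝒳₂] [Fintype 𝒴₁] [Fintype 𝒴₂]
  [Fintype 𝒴₃] (W : Channel 𝒳₁ 𝒳₂ 𝒴₁ 𝒴₂ 𝒴₃) (P : InputDist 𝒰₁ 𝒳₁ 𝒰₂ 𝒳₂)

theorem joint_mem_stdSimplex : joint W P ∈ stdSimplex ℝ (Outcome 𝒰₁ 𝒳₁ 𝒰₂ 𝒳₂ 𝒴₁ 𝒴₂ 𝒴₃) := by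
  constructor
  · intro ω
    unfold joint
    apply_rules [mul_nonneg, stdSimplex.zero_le]
  · simp [joint, Fintype.sum_prod_type, ← Finset.mul_sum]

theorem law_broadcast :
    law (joint W P) (fun ω => (U₁ ω, X₁ ω, X₂ ω, Y₁ ω, Y₂ ω)) =
      broadcastJoint W (compProd P.pU₁ P.pX₁) (mixture P.pU₂ P.pX₂) := by
  funext ⟨u₁, x₁, x₂, y₁, y₂⟩
  calc law (joint W P) (fun ω => (U₁ ω, X₁ ω, X₂ ω, Y₁ ω, Y₂ ω)) (u₁, x₁, x₂, y₁, y₂)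
      = ∑ t : 𝒰₂ × 𝒴₃, joint W P (u₁, x₁, t.1, x₂, y₁, y₂, t.2) :=
        law_eq_sum _ (fun ω => (U₂ ω, Y₃ ω)) (by grind [outcome_eq_iff])
    _ = P.pU₁ u₁ * P.pX₁ u₁ x₁ * (∑ u₂, P.pU₂ u₂ * P.pX₂ u₂ x₂) *
          (W.W₁ x₁ y₁ * W.W₂ x₁ x₂ y₂) := by
        simp only [joint, Fintype.sum_prod_type, ← Finset.mul_sum, stdSimplex.sum_eq_one, mul_one]
        simp only [Finset.mul_sum, Finset.sum_mul, mul_assoc]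
    _ = broadcastJoint W (compProd P.pU₁ P.pX₁) (mixture P.pU₂ P.pX₂) (u₁, x₁, x₂, y₁, y₂) := by
        simp only [broadcastJoint, mixture_apply]
        rfl

theorem mutualInfo_U₁_U₂_X₂ : mutualInfo (joint W P) U₁ (fun ω => (U₂ ω, X₂ ω)) = 0 := by
  refine mutualInfo_eq_zero_of_law_eq_mul (joint_mem_stdSimplex W P) (f := P.pU₁)
    (g := compProd P.pU₂ P.pX₂) fun u₁ ⟨u₂, x₂⟩ => ?_
  calc law (joint W P) (fun ω => (U₁ ω, U₂ ω, X₂ ω)) (u₁, u₂, x₂)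
      = ∑ t : 𝒳₁ × 𝒴₁ × 𝒴₂ × 𝒴₃, joint W P (u₁, t.1, u₂, x₂, t.2.1, t.2.2.1, t.2.2.2) :=
        law_eq_sum _ (fun ω => (X₁ ω, Y₁ ω, Y₂ ω, Y₃ ω)) (by grind [outcome_eq_iff])
    _ = P.pU₁ u₁ * (P.pU₂ u₂ * P.pX₂ u₂ x₂) := by
        simp [joint, Fintype.sum_prod_type, ← Finset.mul_sum, ← Finset.sum_mul, mul_assoc]

theorem condMutualInfo_U₁_X₁ :
    condMutualInfo (joint W P) U₁ (fun ω => (U₂ ω, X₂ ω, Y₁ ω, Y₂ ω, Y₃ ω)) X₁ = 0 := by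
  refine condMutualInfo_eq_zero_of_law_eq_mul (joint_mem_stdSimplex W P).1
    (f := fun u₁ x₁ => P.pU₁ u₁ * P.pX₁ u₁ x₁)
    (g := fun (u₂, x₂, y₁, y₂, y₃) x₁ =>
      P.pU₂ u₂ * P.pX₂ u₂ x₂ * (W.W₁ x₁ y₁ * W.W₂ x₁ x₂ y₂ * W.W₃ x₂ y₃))
    fun u₁ ⟨u₂, x₂, y₁, y₂, y₃⟩ x₁ => ?_
  calc law (joint W P) (fun ω => (U₁ ω, (U₂ ω, X₂ ω, Y₁ ω, Y₂ ω, Y₃ ω), X₁ ω))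
        (u₁, (u₂, x₂, y₁, y₂, y₃), x₁)
      = law (joint W P) id (u₁, x₁, u₂, x₂, y₁, y₂, y₃) :=
        law_congr _ (by grind [outcome_eq_iff])
    _ = _ := by
        simp only [law_id, joint]
        ring

theorem condMutualInfo_U₂_X₂ :
    condMutualInfo (joint W P) U₂ (fun ω => (U₁ ω, X₁ ω, Y₁ ω, Y₂ ω, Y₃ ω)) X₂ = 0 := by
  refine condMutualInfo_eq_zero_of_law_eq_mul (joint_mem_stdSimplex W P).1
    (f := fun u₂ x₂ => P.pU₂ u₂ * P.pX₂ u₂ x₂)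
    (g := fun (u₁, x₁, y₁, y₂, y₃) x₂ =>
      P.pU₁ u₁ * P.pX₁ u₁ x₁ * (W.W₁ x₁ y₁ * W.W₂ x₁ x₂ y₂ * W.W₃ x₂ y₃))
    fun u₂ ⟨u₁, x₁, y₁, y₂, y₃⟩ x₂ => ?_
  calc law (joint W P) (fun ω => (U₂ ω, (U₁ ω, X₁ ω, Y₁ ω, Y₂ ω, Y₃ ω), X₂ ω))
        (u₂, (u₁, x₁, y₁, y₂, y₃), x₂)
      = law (joint W P) id (u₁, x₁, u₂, x₂, y₁, y₂, y₃) :=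
        law_congr _ (by grind [outcome_eq_iff])
    _ = _ := by
        simp only [law_id, joint]
        ring

theorem condMutualInfo_X₁_Y₂_U₂ :
    condMutualInfo (joint W P) X₁ Y₂ U₂ = condMutualInfo (joint W P) U₁ Y₂ U₂ +
      condMutualInfo (joint W P) X₁ Y₂ (fun ω => (U₁ ω, U₂ ω)) :=
  condMutualInfo_eq_add_condMutualInfo <|
    condMutualInfo_eq_zero_of_refines (joint_mem_stdSimplex W P).1 (condMutualInfo_U₁_X₁ W P)
      (by grind) (by grind)

theorem mutualInfo_X₁_U₂_Y₂ :
    mutualInfo (joint W P) (fun ω => (X₁ ω, U₂ ω)) Y₂ = mutualInfo (joint W P) U₁ Y₂ +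
      condMutualInfo (joint W P) (fun ω => (X₁ ω, U₂ ω)) Y₂ U₁ :=
  mutualInfo_eq_add_condMutualInfo <|
    condMutualInfo_eq_zero_of_refines (joint_mem_stdSimplex W P).1 (condMutualInfo_U₁_X₁ W P)
      (by grind) (by grind)

theorem mutualInfo_X₁_Y₁ :
    mutualInfo (joint W P) X₁ Y₁ =
      mutualInfo (joint W P) U₁ Y₁ + condMutualInfo (joint W P) X₁ Y₁ U₁ :=
  mutualInfo_eq_add_condMutualInfo <|
    condMutualInfo_eq_zero_of_refines (joint_mem_stdSimplex W P).1 (condMutualInfo_U₁_X₁ W P)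
      (by grind) (by grind)

theorem mutualInfo_U₁_Y₂_le : mutualInfo (joint W P) U₁ Y₂ ≤ condMutualInfo (joint W P) U₁ Y₂ U₂ :=
  mutualInfo_le_condMutualInfo (joint_mem_stdSimplex W P).1
    (mutualInfo_eq_zero_of_refines (joint_mem_stdSimplex W P) (mutualInfo_U₁_U₂_X₂ W P)
      (by grind)) Y₂

theorem condMutualInfo_U₁_Y₂_U₂_le :
    condMutualInfo (joint W P) U₁ Y₂ U₂ ≤ condMutualInfo (joint W P) U₁ Y₂ X₂ := by
  have hp := joint_mem_stdSimplex W P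
  have hX₂ : mutualInfo (joint W P) U₁ X₂ = 0 :=
    mutualInfo_eq_zero_of_refines hp (mutualInfo_U₁_U₂_X₂ W P) (by grind)
  have hU₂ : condMutualInfo (joint W P) U₂ U₁ (fun ω => (Y₂ ω, X₂ ω)) = 0 :=
    condMutualInfo_eq_zero_of_refines hp.1 (condMutualInfo_U₂_X₂ W P) (by grind) (by grind)
  rw [condMutualInfo_comm] at hU₂
  exact condMutualInfo_le_condMutualInfo hp hX₂ hU₂

end Joint

section EraseU₁

variable {𝒰₁ 𝒳₁ 𝒰₂ 𝒳₂ 𝒴₁ 𝒴₂ 𝒴₃ : Type*} [Fintype 𝒰₁] [Fintype 𝒳₁] [Fintype 𝒰₂] [Fintype 𝒳₂]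
  [Fintype 𝒴₁] [Fintype 𝒴₂] [Fintype 𝒴₃]
  (W : Channel 𝒳₁ 𝒳₂ 𝒴₁ 𝒴₂ 𝒴₃) (P : InputDist 𝒰₁ 𝒳₁ 𝒰₂ 𝒳₂)

/-- The input distribution in which `U₁` is replaced by the output of an erasure channel with input
`U₁` and erasure probability `ε`; given an erasure, `X₁` keeps its unconditional law. -/
def InputDist.eraseU₁ (P : InputDist 𝒰₁ 𝒳₁ 𝒰₂ 𝒳₂) (ε : unitInterval) :
    InputDist (Option 𝒰₁) 𝒳₁ 𝒰₂ 𝒳₂ where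
  pU₁ := ⟨fun o => o.elim ε fun u => (1 - ε) * P.pU₁ u, by
    constructor
    · rintro (_ | u)
      · exact ε.2.1
      · exact mul_nonneg (sub_nonneg.2 ε.2.2) (P.pU₁.2.1 u)
    · simp [Fintype.sum_option, ← Finset.mul_sum]⟩
  pX₁ o := o.elim (mixture P.pU₁ P.pX₁) P.pX₁
  pU₂ := P.pU₂
  pX₂ := P.pX₂

theorem joint_eraseU₁ (ε : unitInterval) : joint W (P.eraseU₁ ε) = erase ε (joint W P) := by
  funext ⟨o, x₁, u₂, x₂, y₁, y₂, y₃⟩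
  cases o with
  | none =>
    change (ε : ℝ) * mixture P.pU₁ P.pX₁ x₁ * P.pU₂ u₂ * P.pX₂ u₂ x₂ *
        (W.W₁ x₁ y₁ * W.W₂ x₁ x₂ y₂ * W.W₃ x₂ y₃) =
      ε * ∑ u₁, joint W P (u₁, x₁, u₂, x₂, y₁, y₂, y₃)
    simp only [joint, mixture_apply, ← Finset.sum_mul]
    ring
  | some u₁ =>
    change (1 - (ε : ℝ)) * P.pU₁ u₁ * P.pX₁ u₁ x₁ * P.pU₂ u₂ * P.pX₂ u₂ x₂ *
        (W.W₁ x₁ y₁ * W.W₂ x₁ x₂ y₂ * W.W₃ x₂ y₃) =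
      (1 - ε) * joint W P (u₁, x₁, u₂, x₂, y₁, y₂, y₃)
    simp only [joint]
    ring

variable (ε : unitInterval)

theorem mutualInfo_eraseU₁_U₁_Y₁ : mutualInfo (joint W (P.eraseU₁ ε)) U₁ Y₁ =
    (1 - ε) * mutualInfo (joint W P) U₁ Y₁ := by
  rw [joint_eraseU₁]
  exact mutualInfo_erase_fst (joint_mem_stdSimplex W P).2 ε fun t => t.2.2.2.1

theorem mutualInfo_eraseU₁_U₁_Y₂ : mutualInfo (joint W (P.eraseU₁ ε)) U₁ Y₂ =
    (1 - ε) * mutualInfo (joint W P) U₁ Y₂ := by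
  rw [joint_eraseU₁]
  exact mutualInfo_erase_fst (joint_mem_stdSimplex W P).2 ε fun t => t.2.2.2.2.1

theorem condMutualInfo_eraseU₁_U₁_Y₂_U₂ : condMutualInfo (joint W (P.eraseU₁ ε)) U₁ Y₂ U₂ =
    (1 - ε) * condMutualInfo (joint W P) U₁ Y₂ U₂ := by
  rw [joint_eraseU₁]
  exact condMutualInfo_erase_fst (joint_mem_stdSimplex W P).2 ε (fun t => t.2.2.2.2.1)
    fun t => t.2.1

theorem mutualInfo_eraseU₁_X₂_Y₃ : mutualInfo (joint W (P.eraseU₁ ε)) X₂ Y₃ =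
    mutualInfo (joint W P) X₂ Y₃ := by
  rw [joint_eraseU₁]
  exact mutualInfo_erase_comp_snd ε (joint W P) (fun t => t.2.2.1) fun t => t.2.2.2.2.2

theorem condMutualInfo_eraseU₁_X₂_Y₃_U₂ : condMutualInfo (joint W (P.eraseU₁ ε)) X₂ Y₃ U₂ =
    condMutualInfo (joint W P) X₂ Y₃ U₂ := by
  rw [joint_eraseU₁]
  exact condMutualInfo_erase_comp_snd ε (joint W P) (fun t => t.2.2.1) (fun t => t.2.2.2.2.2)
    fun t => t.2.1

theorem condMutualInfo_eraseU₁_X₁_Y₂_U₁_U₂ :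
    condMutualInfo (joint W (P.eraseU₁ ε)) X₁ Y₂ (fun ω => (U₁ ω, U₂ ω)) =
      condMutualInfo (joint W P) X₁ Y₂ (fun ω => (U₁ ω, U₂ ω)) +
        ε * condMutualInfo (joint W P) U₁ Y₂ U₂ := by
  have hX₁ : condMutualInfo (joint W (P.eraseU₁ ε)) X₁ Y₂ U₂ =
      condMutualInfo (joint W P) X₁ Y₂ U₂ := by
    rw [joint_eraseU₁]
    exact condMutualInfo_erase_comp_snd ε (joint W P) (fun t => t.1) (fun t => t.2.2.2.2.1)
      fun t => t.2.1
  rw [condMutualInfo_X₁_Y₂_U₂, condMutualInfo_X₁_Y₂_U₂, condMutualInfo_eraseU₁_U₁_Y₂_U₂] at hX₁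
  linarith

theorem condMutualInfo_eraseU₁_X₁_U₂_Y₂_U₁ :
    condMutualInfo (joint W (P.eraseU₁ ε)) (fun ω => (X₁ ω, U₂ ω)) Y₂ U₁ =
      condMutualInfo (joint W P) (fun ω => (X₁ ω, U₂ ω)) Y₂ U₁ +
        ε * mutualInfo (joint W P) U₁ Y₂ := by
  have hX₁U₂ : mutualInfo (joint W (P.eraseU₁ ε)) (fun ω => (X₁ ω, U₂ ω)) Y₂ =
      mutualInfo (joint W P) (fun ω => (X₁ ω, U₂ ω)) Y₂ := by
    rw [joint_eraseU₁]
    exact mutualInfo_erase_comp_snd ε (joint W P) (fun t => (t.1, t.2.1)) fun t => t.2.2.2.2.1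
  rw [mutualInfo_X₁_U₂_Y₂, mutualInfo_X₁_U₂_Y₂, mutualInfo_eraseU₁_U₁_Y₂] at hX₁U₂
  linarith

theorem condMutualInfo_eraseU₁_X₁_Y₁_U₁ : condMutualInfo (joint W (P.eraseU₁ ε)) X₁ Y₁ U₁ =
    condMutualInfo (joint W P) X₁ Y₁ U₁ + ε * mutualInfo (joint W P) U₁ Y₁ := by
  have hX₁ : mutualInfo (joint W (P.eraseU₁ ε)) X₁ Y₁ = mutualInfo (joint W P) X₁ Y₁ := by
    rw [joint_eraseU₁]
    exact mutualInfo_erase_comp_snd ε (joint W P) (fun t => t.1) fun t => t.2.2.2.1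
  rw [mutualInfo_X₁_Y₁, mutualInfo_X₁_Y₁, mutualInfo_eraseU₁_U₁_Y₁] at hX₁
  linarith

theorem mutualInfo_eraseU₁_U₁_U₂_Y₂ :
    mutualInfo (joint W (P.eraseU₁ ε)) (fun ω => (U₁ ω, U₂ ω)) Y₂ =
      mutualInfo (joint W P) (fun ω => (U₁ ω, U₂ ω)) Y₂ -
        ε * condMutualInfo (joint W P) U₁ Y₂ U₂ := by
  have hU₂ : mutualInfo (joint W (P.eraseU₁ ε)) U₂ Y₂ = mutualInfo (joint W P) U₂ Y₂ := by
    rw [joint_eraseU₁]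
    exact mutualInfo_erase_comp_snd ε (joint W P) (fun t => t.2.1) fun t => t.2.2.2.2.1
  rw [mutualInfo_prod_left, mutualInfo_prod_left, hU₂, condMutualInfo_eraseU₁_U₁_Y₂_U₂]
  ring

end EraseU₁

section Regions

theorem exists_unitInterval_mul_eq {s a : ℝ} (hs : 0 ≤ s) (hsa : s ≤ a) :
    ∃ ε : unitInterval, ε * a = s :=
  ⟨⟨s / a, unitInterval.div_mem hs (hs.trans hsa) hsa⟩,
    div_mul_cancel_of_imp fun ha => le_antisymm (hsa.trans_eq ha) hs⟩

variable {𝒳₁ 𝒳₂ 𝒴₁ 𝒴₂ 𝒴₃ : Type*} [Fintype 𝒳₁] [Fintype 𝒳₂] [Fintype 𝒴₁] [Fintype 𝒴₂]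
  [Fintype 𝒴₃] {W : Channel 𝒳₁ 𝒳₂ 𝒴₁ 𝒴₂ 𝒴₃}

theorem ObliviousLessNoisy.mutualInfo_le {𝒰₁ : Type} {𝒰₂ : Type*} [Fintype 𝒰₁] [Fintype 𝒰₂]
    (h : ObliviousLessNoisy W) (P : InputDist 𝒰₁ 𝒳₁ 𝒰₂ 𝒳₂) :
    mutualInfo (joint W P) U₁ Y₁ ≤ mutualInfo (joint W P) U₁ Y₂ := by
  have hle := h 𝒰₁ (compProd P.pU₁ P.pX₁) (mixture P.pU₂ P.pX₂)
  simpa only [← law_broadcast, mutualInfo_law] using hle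

theorem CognizantLessNoisy.condMutualInfo_le {𝒰₁ : Type} {𝒰₂ : Type*} [Fintype 𝒰₁] [Fintype 𝒰₂]
    (h : CognizantLessNoisy W) (P : InputDist 𝒰₁ 𝒳₁ 𝒰₂ 𝒳₂) :
    condMutualInfo (joint W P) U₁ Y₂ X₂ ≤ mutualInfo (joint W P) U₁ Y₁ := by
  have hle := h 𝒰₁ (compProd P.pU₁ P.pX₁) (mixture P.pU₂ P.pX₂)
  simpa only [← law_broadcast, mutualInfo_law, condMutualInfo_law] using hle

section FixedInput

variable {𝒰₁ 𝒰₂ : Type*} [Fintype 𝒰₁] [Fintype 𝒰₂] {P : InputDist 𝒰₁ 𝒳₁ 𝒰₂ 𝒳₂}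

theorem exists_mem_superpositionRegion₁At_eraseU₁ {R : ℝ × ℝ × ℝ}
    (h : mutualInfo (joint W P) U₁ Y₁ ≤ mutualInfo (joint W P) U₁ Y₂)
    (hR : R ∈ splitRegion₁At W P) : ∃ ε, R ∈ superpositionRegion₁At W (P.eraseU₁ ε) := by
  obtain ⟨R₁, R₂, R₃⟩ := R
  obtain ⟨hR₁, hR₂, hR₃, hR₁_le, hR₃_le, hR₁₂, hR₁₂₃⟩ := hR
  obtain ⟨ε, hε⟩ := exists_unitInterval_mul_eq (sub_nonneg.2 hR₁_le) (sub_le_self _ hR₁)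
  have hεY₂ : mutualInfo (joint W P) U₁ Y₁ - R₁ ≤ ε * mutualInfo (joint W P) U₁ Y₂ :=
    hε.ge.trans (mul_le_mul_of_nonneg_left h ε.2.1)
  have hεU₂ : ε * mutualInfo (joint W P) U₁ Y₂ ≤ ε * condMutualInfo (joint W P) U₁ Y₂ U₂ :=
    mul_le_mul_of_nonneg_left (mutualInfo_U₁_Y₂_le W P) ε.2.1
  refine ⟨ε, hR₁, hR₂, hR₃, ?_, ?_, ?_, ?_⟩
  · rw [mutualInfo_eraseU₁_U₁_Y₁]
    linarith
  · rw [condMutualInfo_eraseU₁_X₁_Y₂_U₁_U₂]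
    linarith
  · rwa [mutualInfo_eraseU₁_X₂_Y₃]
  · rw [condMutualInfo_eraseU₁_X₁_U₂_Y₂_U₁, condMutualInfo_eraseU₁_X₂_Y₃_U₂]
    linarith

theorem exists_mem_superpositionRegion₂At_eraseU₁ {R : ℝ × ℝ × ℝ}
    (h : condMutualInfo (joint W P) U₁ Y₂ U₂ ≤ mutualInfo (joint W P) U₁ Y₁)
    (hR : R ∈ splitRegion₂At W P) : ∃ ε, R ∈ superpositionRegion₂At W (P.eraseU₁ ε) := by
  obtain ⟨R₁, R₂, R₃⟩ := R
  obtain ⟨hR₁, hR₂, hR₃, hR₂_le, hR₃_le, hR₁₂, hR₂₃, hR₁₂₃⟩ := hR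
  set s := max 0 (R₁ - condMutualInfo (joint W P) X₁ Y₁ U₁)
  have hR₁s : R₁ - condMutualInfo (joint W P) X₁ Y₁ U₁ ≤ s := le_max_right _ _
  obtain ⟨ε, hε⟩ : ∃ ε : unitInterval, ε * condMutualInfo (joint W P) U₁ Y₂ U₂ = s :=
    exists_unitInterval_mul_eq (le_max_left _ _) (max_le (by linarith) (by linarith))
  have hεY₁ : s ≤ ε * mutualInfo (joint W P) U₁ Y₁ :=
    hε.ge.trans (mul_le_mul_of_nonneg_left h ε.2.1)
  refine ⟨ε, hR₁, hR₂, hR₃, ?_, ?_, ?_, ?_⟩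
  · rw [condMutualInfo_eraseU₁_X₁_Y₁_U₁]
    linarith
  · rw [condMutualInfo_eraseU₁_U₁_Y₂_U₂, sub_mul, one_mul, hε, le_sub_comm]
    exact max_le (by linarith) (by linarith)
  · rwa [mutualInfo_eraseU₁_X₂_Y₃]
  · rw [mutualInfo_eraseU₁_U₁_U₂_Y₂, condMutualInfo_eraseU₁_X₂_Y₃_U₂, hε, sub_add_eq_add_sub,
      le_sub_comm]
    exact max_le (by linarith) (by linarith)

theorem superpositionRegion₁At_subset : superpositionRegion₁At W P ⊆ splitRegion₁At W P := by
  rintro ⟨R₁, R₂, R₃⟩ ⟨hR₁, hR₂, hR₃, hR₁_le, hR₂_le, hR₃_le, hR₂₃⟩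
  exact ⟨hR₁, hR₂, hR₃, hR₁_le, hR₃_le, by linarith, by linarith⟩

theorem superpositionRegion₂At_subset : superpositionRegion₂At W P ⊆ splitRegion₂At W P := by
  rintro ⟨R₁, R₂, R₃⟩ ⟨hR₁, hR₂, hR₃, hR₁_le, hR₂_le, hR₃_le, hR₂₃⟩
  exact ⟨hR₁, hR₂, hR₃, hR₂_le, hR₃_le, by linarith, hR₂₃, by linarith⟩

end FixedInput

theorem superpositionRegion₁_subset (W : Channel 𝒳₁ 𝒳₂ 𝒴₁ 𝒴₂ 𝒴₃) :
    superpositionRegion₁ W ⊆ splitRegion₁ W :=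
  fun _ ⟨𝒰₁, 𝒰₂, _, _, P, hR⟩ => ⟨𝒰₁, 𝒰₂, _, _, P, superpositionRegion₁At_subset hR⟩

theorem superpositionRegion₂_subset (W : Channel 𝒳₁ 𝒳₂ 𝒴₁ 𝒴₂ 𝒴₃) :
    superpositionRegion₂ W ⊆ splitRegion₂ W :=
  fun _ ⟨𝒰₁, 𝒰₂, _, _, P, hR⟩ => ⟨𝒰₁, 𝒰₂, _, _, P, superpositionRegion₂At_subset hR⟩

theorem ObliviousLessNoisy.splitRegion₁_subset (h : ObliviousLessNoisy W) :
    splitRegion₁ W ⊆ superpositionRegion₁ W := by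
  rintro R ⟨𝒰₁, 𝒰₂, _, _, P, hR⟩
  obtain ⟨ε, hε⟩ := exists_mem_superpositionRegion₁At_eraseU₁ (h.mutualInfo_le P) hR
  exact ⟨Option 𝒰₁, 𝒰₂, _, _, P.eraseU₁ ε, hε⟩

theorem CognizantLessNoisy.splitRegion₂_subset (h : CognizantLessNoisy W) :
    splitRegion₂ W ⊆ superpositionRegion₂ W := by
  rintro R ⟨𝒰₁, 𝒰₂, _, _, P, hR⟩
  have hle : condMutualInfo (joint W P) U₁ Y₂ U₂ ≤ mutualInfo (joint W P) U₁ Y₁ :=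
    (condMutualInfo_U₁_Y₂_U₂_le W P).trans (h.condMutualInfo_le P)
  obtain ⟨ε, hε⟩ := exists_mem_superpositionRegion₂At_eraseU₁ hle hR
  exact ⟨Option 𝒰₁, 𝒰₂, _, _, P.eraseU₁ ε, hε⟩

end Regions

end BIC

end

theorem mainTheorem2 {𝒳₁ 𝒳₂ 𝒴₁ 𝒴₂ 𝒴₃ : Type*}
    [Fintype 𝒳₁] [Fintype 𝒳₂] [Fintype 𝒴₁] [Fintype 𝒴₂] [Fintype 𝒴₃]
    (W : BIC.Channel 𝒳₁ 𝒳₂ 𝒴₁ 𝒴₂ 𝒴₃) :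
    (BIC.ObliviousLessNoisy W → BIC.splitRegion₁ W = BIC.superpositionRegion₁ W) ∧
    (BIC.CognizantLessNoisy W → BIC.splitRegion₂ W = BIC.superpositionRegion₂ W) :=
  ⟨fun h => h.splitRegion₁_subset.antisymm (BIC.superpositionRegion₁_subset W),
    fun h => h.splitRegion₂_subset.antisymm (BIC.superpositionRegion₂_subset W)⟩
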